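/- Let $F$ be a finite field of characteristic $p$, and let $K$ be a commutative ring in which $p$ is invertible. Let $\mathrm{Rep}(F;K)$ be the category whose objects are all functors (not necessarily additive) from the category of finite-dimensional $F$-vector spaces to the category of $K$-modules, and whose morphisms are the natural transformations. Then there is an equivalence of $K$-linear abelian categories $$\mathrm{Rep}(F;K)\;\simeq\;\prod_{n=0}^{\infty} K[GL_n(F)]\text{-modules},$$ that is, an equivalence of categories given by an additive $K$-linear functor, where addition and scalar multiplication of morphisms on the left are pointwise and on the right are componentwise. Moreover the equivalence is natural in the following sense: for every $n\ge 0$, its $n$-th component is naturally isomorphic to the functor that sends $G\in\mathrm{Rep}(F;K)$ to the $K$-submodule $$\{x\in G(F^n) \;:\; G(A)(x)=0 \text{ for all } A\in M_n(F) \text{ with } \det A=0\}$$ of $G(F^n)$, with $g\in GL_n(F)$ acting by $G(g)$, and sends a natural transformation $f$ to the restriction of $f_{F^n}$. -/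

import Mathlib

open CategoryTheory
open scoped ModuleCat.Algebra

universe u v w

noncomputable section

/-! ### Products of `K`-linear categories -/

section Product

variable {I : Type*} {C : I → Type*} [∀ i, Category (C i)]

/-- A product of preadditive categories is preadditive, with componentwise addition of morphisms. -/
instance piPreadditive [∀ i, Preadditive (C i)] : Preadditive (∀ i, C i) where
  homGroup X Y := inferInstanceAs (AddCommGroup (∀ i, X i ⟶ Y i))
  add_comp _ _ _ f f' g := funext fun i => Preadditive.add_comp _ _ _ (f i) (f' i) (g i)
  comp_add _ _ _ f g g' := funext fun i => Preadditive.comp_add _ _ _ (f i) (g i) (g' i)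

/-- A product of `K`-linear categories is `K`-linear, with componentwise scalar multiplication of
morphisms. -/
instance piLinear (K : Type*) [Semiring K] [∀ i, Preadditive (C i)] [∀ i, Linear K (C i)] :
    Linear K (∀ i, C i) where
  homModule X Y := inferInstanceAs (Module K (∀ i, X i ⟶ Y i))
  smul_comp _ _ _ r f g := funext fun i => Linear.smul_comp _ _ _ r (f i) (g i)
  comp_smul _ _ _ f r g := funext fun i => Linear.comp_smul _ _ _ (f i) r (g i)

end Product

/-! ### Generic representations -/

section Generic

variable (F : Type u) [Field F] (K : Type v) [CommRing K]

/-- The category of functors from finite-dimensional `F`-vector spaces to `K`-modules, with natural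
transformations as morphisms. No additivity is required of the functors. -/
abbrev GenericRep : Type _ := FGModuleCat.{u} F ⥤ ModuleCat.{w} K

/-- The product over `n ≥ 0` of the categories of (left) `K[GL_n(F)]`-modules. -/
abbrev ProdGLModules : Type _ :=
  ∀ n : ℕ, ModuleCat.{w} (MonoidAlgebra K (Matrix.GeneralLinearGroup (Fin n) F))

variable {F K}

/-- The action of the monoid `M_n(F)` of all `n × n` matrices on `G(F^n)`. -/
def GenericRep.matrixRep (G : GenericRep.{u, v, w} F K) (n : ℕ) :
    Representation K (Matrix (Fin n) (Fin n) F) (G.obj (FGModuleCat.of F (Fin n → F))) where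
  toFun A := (G.map (FGModuleCat.ofHom (Matrix.toLin' A))).hom
  map_one' := by
    have h : FGModuleCat.ofHom (Matrix.toLin' (1 : Matrix (Fin n) (Fin n) F)) = 𝟙 _ := by
      rw [Matrix.toLin'_one]; rfl
    rw [h, G.map_id]; rfl
  map_mul' A B := by
    have h : FGModuleCat.ofHom (Matrix.toLin' (A * B)) =
        FGModuleCat.ofHom (Matrix.toLin' B) ≫ FGModuleCat.ofHom (Matrix.toLin' A) := by
      rw [Matrix.toLin'_mul]; rfl
    rw [h, G.map_comp]; rfl

/-- The submodule of `G(F^n)` of the elements annihilated by all singular `n × n` matrices. -/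
def GenericRep.purePart (G : GenericRep.{u, v, w} F K) (n : ℕ) :
    Submodule K (G.obj (FGModuleCat.of F (Fin n → F))) :=
  ⨅ A : {A : Matrix (Fin n) (Fin n) F // A.det = 0}, LinearMap.ker (G.matrixRep n A.1)

theorem GenericRep.mem_purePart {G : GenericRep.{u, v, w} F K} {n : ℕ}
    {x : G.obj (FGModuleCat.of F (Fin n → F))} :
    x ∈ G.purePart n ↔ ∀ A : Matrix (Fin n) (Fin n) F, A.det = 0 → G.matrixRep n A x = 0 := by
  simp [GenericRep.purePart]

/-- The action of `GL_n(F)` on the elements of `G(F^n)` annihilated by all singular matrices. -/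
def GenericRep.pureRep (G : GenericRep.{u, v, w} F K) (n : ℕ) :
    Representation K (Matrix.GeneralLinearGroup (Fin n) F) (G.purePart n) :=
  Representation.subrepresentation
    ((G.matrixRep n).comp (Units.coeHom (Matrix (Fin n) (Fin n) F))) (G.purePart n) (by
      intro g x hx
      rw [Submodule.mem_comap, GenericRep.mem_purePart]
      intro A hA
      have h := GenericRep.mem_purePart.1 hx (A * g.1) (by rw [Matrix.det_mul, hA, zero_mul])
      rw [map_mul] at h
      exact h)

theorem GenericRep.map_mem_purePart {G H : GenericRep.{u, v, w} F K} (f : G ⟶ H) (n : ℕ)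
    (x : G.obj (FGModuleCat.of F (Fin n → F))) (hx : x ∈ G.purePart n) :
    (f.app _).hom x ∈ H.purePart n := by
  rw [GenericRep.mem_purePart] at hx ⊢
  intro A hA
  have h := congrArg (f.app (FGModuleCat.of F (Fin n → F))).hom (hx A hA)
  rw [map_zero] at h
  rw [← h]
  exact (NatTrans.naturality_apply f (FGModuleCat.ofHom (Matrix.toLin' A)) x).symm

variable (F K)

/-- The functor sending `G` to the `K[GL_n(F)]`-module of the elements of `G(F^n)` annihilated by
all singular matrices, and a natural transformation `f` to the restriction of its component
`f_{F^n}`. -/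
def purePartFunctor (n : ℕ) : GenericRep.{u, v, w} F K ⥤
    ModuleCat.{w} (MonoidAlgebra K (Matrix.GeneralLinearGroup (Fin n) F)) :=
  { obj := fun G => Rep.of (G.pureRep n)
    map := fun {G H} f => Rep.ofHom
      { toLinearMap := (f.app _).hom.restrict (GenericRep.map_mem_purePart f n)
        isIntertwining' := fun g => by
          ext x
          exact NatTrans.naturality_apply f (FGModuleCat.ofHom (Matrix.toLin' g.1)) x.1 }
    map_id := fun G => by ext x; rfl
    map_comp := fun f g => by ext x; rfl : GenericRep.{u, v, w} F K ⥤
      Rep.{w} K (Matrix.GeneralLinearGroup (Fin n) F) } ⋙ Rep.toModuleMonoidAlgebra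

end Generic

end

/-! The heart is Kovács' theorem: when p is invertible in K, the span S of the singular matrices in
K[M_n(F)] has an identity element 1 - e. Then e is a central idempotent annihilating S on both
sides, and for every G it projects G(F^n) onto the pure part.

Let Ann be the right annihilator of S. Since S + Ann is a two-sided ideal, it is enough to put 1 in
it; transposition then makes the Ann-component of 1 two-sided. This goes by induction on n. For each
matrix g, the sum T(g) of the h with tr(hg) = 1 minus those with tr(hg) = 0 lies in S + Ann: for
invertible g it is in Ann (`traceSum_mem_singularAnn`), and for singular g it is, up to a unit of K
and right multiplication by a unit matrix, a multiple of a sum of unipotent matrices that the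
induction hypothesis controls (`unipotentSum_mem_singularSup`). Summing T(g) over all g of trace 1
leaves a power of p times 1 - [0] (`natCast_card_mem_singularSup`).

The inverse functor sends (M_n) to V ↦ the families of GL_n-equivariant functions Hom(V, F^n) → M_n
vanishing off the surjections. The unit sends x in G(V) to s ↦ e_n G(s) x; it is bijective on each
F^n by strong induction, because a singular endomorphism factors through a smaller F^m. The counit
is evaluation at the identity of F^n, and is bijective without any condition on p. -/

open scoped Matrix

noncomputable section

/-! ### The span of the singular matrices and its annihilator -/

section Kovacs

variable {F : Type*} [Field F] (K : Type*) [CommRing K]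
variable {ι : Type*} [Fintype ι] [DecidableEq ι]

/-- The span of the singular matrices in the monoid algebra of the matrix monoid. -/
def singularSpan (F : Type*) [Field F] (K : Type*) [CommRing K]
    (ι : Type*) [Fintype ι] [DecidableEq ι] : Submodule K (MonoidAlgebra K (Matrix ι ι F)) :=
  Submodule.span K (MonoidAlgebra.of K _ '' {A : Matrix ι ι F | A.det = 0})

variable {K}

theorem of_mem_singularSpan {A : Matrix ι ι F} (hA : A.det = 0) :
    MonoidAlgebra.of K _ A ∈ singularSpan F K ι :=
  Submodule.subset_span ⟨A, hA, rfl⟩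

theorem mul_mem_singularSpan (r : MonoidAlgebra K (Matrix ι ι F))
    {x : MonoidAlgebra K (Matrix ι ι F)} (hx : x ∈ singularSpan F K ι) :
    r * x ∈ singularSpan F K ι := by
  induction r using MonoidAlgebra.induction_on with
  | of B =>
    induction hx using Submodule.span_induction with
    | mem y hy =>
      obtain ⟨A, hA, rfl⟩ := hy
      rw [← map_mul]
      exact of_mem_singularSpan (by simp [Matrix.det_mul, hA.out])
    | zero => simp
    | add y z _ _ hy hz => rw [mul_add]; exact add_mem hy hz
    | smul a y _ hy => rw [mul_smul_comm]; exact Submodule.smul_mem _ _ hy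
  | add a b ha hb => rw [add_mul]; exact add_mem ha hb
  | smul c a ha => rw [smul_mul_assoc]; exact Submodule.smul_mem _ _ ha

theorem singularSpan_mul_mem (r : MonoidAlgebra K (Matrix ι ι F))
    {x : MonoidAlgebra K (Matrix ι ι F)} (hx : x ∈ singularSpan F K ι) :
    x * r ∈ singularSpan F K ι := by
  induction r using MonoidAlgebra.induction_on with
  | of B =>
    induction hx using Submodule.span_induction with
    | mem y hy =>
      obtain ⟨A, hA, rfl⟩ := hy
      rw [← map_mul]
      exact of_mem_singularSpan (by simp [Matrix.det_mul, hA.out])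
    | zero => simp
    | add y z _ _ hy hz => rw [add_mul]; exact add_mem hy hz
    | smul a y _ hy => rw [smul_mul_assoc]; exact Submodule.smul_mem _ _ hy
  | add a b ha hb => rw [mul_add]; exact add_mem ha hb
  | smul c a ha => rw [mul_smul_comm]; exact Submodule.smul_mem _ _ ha

/-- The right annihilator of the singular matrices. -/
def singularAnn (F : Type*) [Field F] (K : Type*) [CommRing K]
    (ι : Type*) [Fintype ι] [DecidableEq ι] : Submodule K (MonoidAlgebra K (Matrix ι ι F)) where
  carrier := {x | ∀ A : Matrix ι ι F, A.det = 0 → MonoidAlgebra.of K _ A * x = 0}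
  add_mem' hx hy A hA := by rw [mul_add, hx A hA, hy A hA, add_zero]
  zero_mem' A _ := mul_zero _
  smul_mem' c x hx A hA := by rw [mul_smul_comm, hx A hA, smul_zero]

theorem singularSpan_mul_singularAnn {s x : MonoidAlgebra K (Matrix ι ι F)}
    (hs : s ∈ singularSpan F K ι) (hx : x ∈ singularAnn F K ι) : s * x = 0 := by
  induction hs using Submodule.span_induction with
  | mem y hy =>
    obtain ⟨A, hA, rfl⟩ := hy
    exact hx A hA
  | zero => simp
  | add y z _ _ hy hz => rw [add_mul, hy, hz, add_zero]
  | smul a y _ hy => rw [smul_mul_assoc, hy, smul_zero]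

/-- The sum of the span of the singular matrices and of its right annihilator. -/
def singularSup (F : Type*) [Field F] (K : Type*) [CommRing K]
    (ι : Type*) [Fintype ι] [DecidableEq ι] : Submodule K (MonoidAlgebra K (Matrix ι ι F)) :=
  singularAnn F K ι ⊔ singularSpan F K ι

/-- Singular times anything is again in the span, which the annihilator component kills. With the
next lemma, the sum is a two-sided ideal. -/
theorem mul_mem_singularSup (r : MonoidAlgebra K (Matrix ι ι F))
    {x : MonoidAlgebra K (Matrix ι ι F)} (hx : x ∈ singularSup F K ι) :
    r * x ∈ singularSup F K ι := by
  obtain ⟨a, ha, s, hs, rfl⟩ := Submodule.mem_sup.1 hx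
  rw [mul_add]
  refine Submodule.add_mem_sup (fun A hA => ?_) (mul_mem_singularSpan r hs)
  rw [← mul_assoc]
  exact singularSpan_mul_singularAnn (singularSpan_mul_mem r (of_mem_singularSpan hA)) ha

theorem singularSup_mul_mem (r : MonoidAlgebra K (Matrix ι ι F))
    {x : MonoidAlgebra K (Matrix ι ι F)} (hx : x ∈ singularSup F K ι) :
    x * r ∈ singularSup F K ι := by
  obtain ⟨a, ha, s, hs, rfl⟩ := Submodule.mem_sup.1 hx
  rw [add_mul]
  refine Submodule.add_mem_sup (fun A hA => ?_) (singularSpan_mul_mem r hs)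
  rw [← mul_assoc, ha A hA, zero_mul]

/-! ### Passing from size n to size n + 1 by block triangular matrices -/

section BlockInduction

variable {κ : Type*}

/-- The block upper triangular matrix with diagonal blocks `f` and `s` and corner `u`. -/
def blockUpper (f : Matrix κ κ F) (u : κ → F) (s : F) : Matrix (κ ⊕ Unit) (κ ⊕ Unit) F :=
  Matrix.fromBlocks f (Matrix.replicateCol Unit u) 0 (Matrix.of fun _ _ => s)

theorem blockUpper_eq_add (f g : Matrix κ κ F) (u w : κ → F) (s t : F) :
    blockUpper (f + g) (u + w) (s + t) = blockUpper f u s + blockUpper g w t := by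
  ext (i | i) (j | j) <;> simp [blockUpper]

theorem mul_blockUpper_eq_zero [Fintype κ] {A : Matrix (κ ⊕ Unit) (κ ⊕ Unit) F} {v : κ ⊕ Unit → F}
    (hv : A *ᵥ v = 0) {f : Matrix κ κ F} {u : κ → F} {s : F} (r : κ ⊕ Unit → F)
    (h : blockUpper f u s = Matrix.vecMulVec v r) : A * blockUpper f u s = 0 := by
  rw [h, Matrix.mul_vecMulVec, hv, Matrix.zero_vecMulVec]

variable [Fintype κ] [DecidableEq κ]

theorem det_blockUpper (f : Matrix κ κ F) (u : κ → F) (s : F) :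
    (blockUpper f u s).det = f.det * s := by
  simp [blockUpper, Matrix.det_fromBlocks_zero₂₁]

variable (K) in
/-- The linear extension of `f ↦ blockUpper f u s`. -/
def blockUpperMap (u : κ → F) (s : F) : MonoidAlgebra K (Matrix κ κ F) →ₗ[K]
    MonoidAlgebra K (Matrix (κ ⊕ Unit) (κ ⊕ Unit) F) :=
  MonoidAlgebra.mapDomainLinearMap K K fun f => blockUpper f u s

@[simp]
theorem blockUpperMap_of (f : Matrix κ κ F) (u : κ → F) (s : F) :
    blockUpperMap K u s (MonoidAlgebra.of K _ f) = MonoidAlgebra.of K _ (blockUpper f u s) := by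
  simp [blockUpperMap]

theorem blockUpperMap_mem_singularSpan {x : MonoidAlgebra K (Matrix κ κ F)}
    (hx : x ∈ singularSpan F K κ) (u : κ → F) (s : F) :
    blockUpperMap K u s x ∈ singularSpan F K (κ ⊕ Unit) := by
  induction hx using Submodule.span_induction with
  | mem y hy =>
    obtain ⟨A, hA, rfl⟩ := hy
    rw [blockUpperMap_of]
    exact of_mem_singularSpan (by rw [det_blockUpper, hA.out, zero_mul])
  | zero => simp
  | add y z _ _ hy hz => rw [map_add]; exact add_mem hy hz
  | smul a y _ hy => rw [map_smul]; exact Submodule.smul_mem _ _ hy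

theorem blockUpperMap_zero_mem_singularSpan (x : MonoidAlgebra K (Matrix κ κ F)) (u : κ → F) :
    blockUpperMap K u 0 x ∈ singularSpan F K (κ ⊕ Unit) := by
  induction x using MonoidAlgebra.induction_on with
  | of B =>
    rw [blockUpperMap_of]
    exact of_mem_singularSpan (by rw [det_blockUpper, mul_zero])
  | add y z hy hz => rw [map_add]; exact add_mem hy hz
  | smul a y hy => rw [map_smul]; exact Submodule.smul_mem _ _ hy

/-- Adding to the columns of a block matrix multiples of a kernel vector of A does not change its
product with A; this carries such a change over to the monoid algebra. -/
theorem of_mul_blockUpperMap_congr {A : Matrix (κ ⊕ Unit) (κ ⊕ Unit) F} {u u' : κ → F} {s s' : F}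
    {P : Matrix κ κ F} (h : ∀ f, A * blockUpper f u s = A * blockUpper (P * f) u' s')
    (x : MonoidAlgebra K (Matrix κ κ F)) :
    MonoidAlgebra.of K _ A * blockUpperMap K u s x =
      MonoidAlgebra.of K _ A * blockUpperMap K u' s' (MonoidAlgebra.of K _ P * x) := by
  induction x using MonoidAlgebra.induction_on with
  | of B => rw [← map_mul, blockUpperMap_of, blockUpperMap_of, ← map_mul, ← map_mul, h]
  | add y z hy hz => simp only [map_add, mul_add, hy, hz]
  | smul a y hy => simp only [map_smul, mul_smul_comm, hy]

/-- The sum of all `blockUpper 1 u 1`. -/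
def unipotentSum (F : Type*) [Field F] [Fintype F] (K : Type*) [CommRing K]
    (κ : Type*) [Fintype κ] [DecidableEq κ] :
    MonoidAlgebra K (Matrix (κ ⊕ Unit) (κ ⊕ Unit) F) :=
  ∑ u : κ → F, MonoidAlgebra.of K _ (blockUpper 1 u 1)

/-- Take v ≠ 0 with A v = 0. If its last coordinate is 0, every term dies, since A only sees x
multiplied by a singular matrix of size n. Otherwise v can clear the corner entry 1 at the cost of
translating u, and the two sums over u cancel. -/
theorem sum_blockUpperMap_mem_singularAnn [Fintype F] {x : MonoidAlgebra K (Matrix κ κ F)}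
    (hx : x ∈ singularAnn F K κ) :
    ∑ u : κ → F, (blockUpperMap K u 1 x - blockUpperMap K u 0 x) ∈
      singularAnn F K (κ ⊕ Unit) := by
  intro A hA
  obtain ⟨v, hv0, hv⟩ := Matrix.exists_mulVec_eq_zero_iff.2 hA
  by_cases ht : v (Sum.inr ()) = 0
  · obtain ⟨i, hi⟩ : ∃ i, v (Sum.inl i) ≠ 0 := by
      by_contra! h
      exact hv0 (funext fun i => by rcases i with i | i; exacts [h i, ht])
    have key : ∀ u s, MonoidAlgebra.of K _ A * blockUpperMap K u s x = 0 := by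
      intro u s
      set w : κ → F := fun j => v (Sum.inl j)
      -- This matrix is the projection with kernel the line of w; it differs from 1 by columns
      -- proportional to w, which A ignores.
      have hdet : (1 - Matrix.vecMulVec w (Pi.single i (w i)⁻¹) : Matrix κ κ F).det = 0 := by
        refine Matrix.exists_mulVec_eq_zero_iff.1 ⟨w, fun h => hi (congrFun h i), ?_⟩
        rw [Matrix.sub_mulVec, Matrix.one_mulVec, Matrix.vecMulVec_mulVec]
        ext j
        simp [inv_mul_cancel₀ hi, w]
      rw [of_mul_blockUpperMap_congr (u' := u) (s' := s)
        (P := 1 - Matrix.vecMulVec w (Pi.single i (w i)⁻¹)), hx _ hdet, map_zero, mul_zero]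
      intro f
      have h1 : f = (1 - Matrix.vecMulVec w (Pi.single i (w i)⁻¹)) * f +
          Matrix.vecMulVec w (Pi.single i (w i)⁻¹) * f := by
        rw [← add_mul, sub_add_cancel, one_mul]
      conv_lhs => rw [h1, ← add_zero u, ← add_zero s, blockUpper_eq_add, mul_add]
      rw [mul_blockUpper_eq_zero (f := Matrix.vecMulVec w (Pi.single i (w i)⁻¹) * f) (u := 0) (s := 0)
        hv (Sum.elim ((Pi.single i (w i)⁻¹) ᵥ* f) 0), add_zero]
      ext (j | j) (k | k) <;>
        simp [blockUpper, Matrix.vecMulVec_mul, Matrix.vecMulVec_apply, ht, w, mul_left_comm]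
    rw [Finset.mul_sum]
    exact Finset.sum_eq_zero fun u _ => by rw [mul_sub, key, key, sub_zero]
  · set w : κ → F := fun j => v (Sum.inl j) / v (Sum.inr ())
    have key : ∀ u, MonoidAlgebra.of K _ A * blockUpperMap K u 1 x =
        MonoidAlgebra.of K _ A * blockUpperMap K (u - w) 0 x := by
      intro u
      rw [of_mul_blockUpperMap_congr (u' := u - w) (s' := 0) (P := 1), map_one, one_mul]
      intro f
      rw [one_mul]
      conv_lhs => rw [← add_zero f, ← sub_add_cancel u w, ← zero_add (1 : F), blockUpper_eq_add,
        mul_add]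
      rw [mul_blockUpper_eq_zero (f := 0) (u := w) (s := 1) hv
        (Sum.elim 0 fun _ => (v (Sum.inr ()))⁻¹), add_zero]
      ext (j | j) (k | k) <;>
        simp [blockUpper, Matrix.vecMulVec_apply, w, div_eq_mul_inv, ht]
    simp only [Finset.mul_sum, mul_sub, Finset.sum_sub_distrib, key]
    rw [sub_eq_zero]
    exact (Equiv.subRight w).sum_comp
      fun u => MonoidAlgebra.of K _ A * blockUpperMap K u 0 x

/-- Write 1 = x + s in size n. Subtracting the terms with corner 0, which are singular, turns the
x-part into an element of the annihilator; the s-part stays singular. -/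
theorem unipotentSum_mem_singularSup [Fintype F]
    (h : (1 : MonoidAlgebra K (Matrix κ κ F)) ∈ singularSup F K κ) :
    unipotentSum F K κ ∈ singularSup F K (κ ⊕ Unit) := by
  obtain ⟨x, hx, s, hs, hxs⟩ := Submodule.mem_sup.1 h
  have : unipotentSum F K κ = ∑ u : κ → F, (blockUpperMap K u 1 x - blockUpperMap K u 0 x) +
      ∑ u : κ → F, (blockUpperMap K u 1 s + blockUpperMap K u 0 x) := by
    rw [← Finset.sum_add_distrib]
    refine Finset.sum_congr rfl fun u _ => ?_
    rw [← blockUpperMap_of, map_one, ← hxs, map_add]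
    abel
  rw [this]
  exact Submodule.add_mem_sup (sum_blockUpperMap_mem_singularAnn hx)
    (Submodule.sum_mem _ fun u _ => add_mem (blockUpperMap_mem_singularSpan hs u 1)
      (blockUpperMap_zero_mem_singularSpan x u))

end BlockInduction

end Kovacs

/-! ### Trace sums and Kovács' theorem -/

section Kovacs

variable {F : Type*} [Field F] {K : Type*} [CommRing K]

section Field

variable {ι : Type*} [Fintype ι] [DecidableEq ι]

variable (K) in
/-- The linear extension of matrix transposition. -/
def transposeMap (ι : Type*) : MonoidAlgebra K (Matrix ι ι F) →ₗ[K] MonoidAlgebra K (Matrix ι ι F) :=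
  MonoidAlgebra.mapDomainLinearMap K K Matrix.transpose

theorem transposeMap_of (A : Matrix ι ι F) :
    transposeMap K ι (MonoidAlgebra.of K _ A) = MonoidAlgebra.of K _ Aᵀ := by
  simp [transposeMap]

theorem transposeMap_of_mul (A : Matrix ι ι F) (x : MonoidAlgebra K (Matrix ι ι F)) :
    transposeMap K ι (MonoidAlgebra.of K _ A * x) =
      transposeMap K ι x * MonoidAlgebra.of K _ Aᵀ := by
  induction x using MonoidAlgebra.induction_on with
  | of B => rw [← map_mul, transposeMap_of, transposeMap_of, ← map_mul, Matrix.transpose_mul]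
  | add y z hy hz => simp only [map_add, mul_add, add_mul, hy, hz]
  | smul a y hy => simp only [map_smul, mul_smul_comm, smul_mul_assoc, hy]

theorem transposeMap_mem_singularSpan {x : MonoidAlgebra K (Matrix ι ι F)}
    (hx : x ∈ singularSpan F K ι) : transposeMap K ι x ∈ singularSpan F K ι := by
  induction hx using Submodule.span_induction with
  | mem y hy =>
    obtain ⟨A, hA, rfl⟩ := hy
    rw [transposeMap_of]
    exact of_mem_singularSpan (by rw [Matrix.det_transpose, hA.out])
  | zero => simp
  | add y z _ _ hy hz => rw [map_add]; exact add_mem hy hz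
  | smul a y _ hy => rw [map_smul]; exact Submodule.smul_mem _ _ hy

theorem exists_isUnit_row_eq {κ : Type*} [Fintype κ] [DecidableEq κ] {r : κ ⊕ Unit → F} (hr : r ≠ 0) :
    ∃ k : (Matrix (κ ⊕ Unit) (κ ⊕ Unit) F)ˣ, k.1 (Sum.inr ()) = r := by
  obtain ⟨i, hi⟩ := Function.ne_iff.1 hr
  -- The identity with row i replaced by r has determinant r i ≠ 0; the swap brings that row to the
  -- last place.
  have hu : IsUnit (((1 : Matrix (κ ⊕ Unit) (κ ⊕ Unit) F).updateRow i r).submatrix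
      (Equiv.swap i (Sum.inr ())) id) := by
    rw [Matrix.isUnit_iff_isUnit_det, Matrix.det_permute, isUnit_iff_ne_zero]
    have : ((1 : Matrix (κ ⊕ Unit) (κ ⊕ Unit) F).updateRow i r).det = r i := by
      rw [← Matrix.cramer_transpose_apply, Matrix.transpose_one, Matrix.cramer_one]
      rfl
    rw [this]
    refine mul_ne_zero ?_ hi
    rcases Int.units_eq_one_or (Equiv.Perm.sign (Equiv.swap i (Sum.inr ()))) with h | h <;>
      simp [h]
  obtain ⟨k, hk⟩ := hu
  refine ⟨k, ?_⟩
  rw [hk]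
  ext j
  simp

theorem one_mem_singularSup_of_equiv {κ : Type*} [Fintype κ] [DecidableEq κ] (e : κ ≃ ι)
    (h : (1 : MonoidAlgebra K (Matrix κ κ F)) ∈ singularSup F K κ) :
    (1 : MonoidAlgebra K (Matrix ι ι F)) ∈ singularSup F K ι := by
  obtain ⟨x, hx, s, hs, hxs⟩ := Submodule.mem_sup.1 h
  set Φ := MonoidAlgebra.mapDomainAlgHom K K (MonoidHomClass.toMonoidHom (Matrix.reindexAlgEquiv F F e))
  have hΦ : ∀ B, Φ (MonoidAlgebra.of K _ B) = MonoidAlgebra.of K _ (Matrix.reindex e e B) := by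
    intro B
    simp [Φ]
  rw [← map_one Φ, ← hxs, map_add]
  refine Submodule.add_mem_sup (fun A hA => ?_) ?_
  · have : A = Matrix.reindex e e (Matrix.reindex e.symm e.symm A) := by ext; simp
    rw [this, ← hΦ, ← map_mul, hx _ (by rwa [Matrix.det_reindex_self]), map_zero]
  · clear hxs
    induction hs using Submodule.span_induction with
    | mem y hy =>
      obtain ⟨A, hA, rfl⟩ := hy
      rw [hΦ]
      exact of_mem_singularSpan (by rw [Matrix.det_reindex_self, hA.out])
    | zero => simp
    | add y z _ _ hy hz => rw [map_add]; exact add_mem hy hz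
    | smul a y _ hy => rw [map_smul]; exact Submodule.smul_mem _ _ hy

end Field

variable [DecidableEq F]

/-- The function on `F` with value `1` at `1`, `-1` at `0`, and `0` elsewhere. -/
def oneSubZero (F : Type*) [Field F] [DecidableEq F] (K : Type*) [CommRing K] (a : F) : K :=
  (if a = 1 then 1 else 0) - (if a = 0 then 1 else 0)

/-- Translation by m matches the terms with t = 0 with those with t = 1, and f does not notice it.
-/
theorem sum_oneSubZero_smul_eq_zero {M N : Type*} [AddGroup M] [Fintype M] [AddCommGroup N]
    [Module K N] (t : M → F) (f : M → N) (m : M) (ht : ∀ h, t (h + m) = t h + 1)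
    (hf : ∀ h, f (h + m) = f h) : ∑ h, oneSubZero F K (t h) • f h = 0 := by
  simp only [oneSubZero, sub_smul, Finset.sum_sub_distrib]
  rw [sub_eq_zero, ← Equiv.sum_comp (Equiv.addRight m)]
  simp [ht, hf]

variable [Fintype F] {ι : Type*} [Fintype ι] [DecidableEq ι]

variable (K) in
/-- The sum of all matrices `h`, with coefficients depending on the trace of `h * g`. -/
def traceSum (g : Matrix ι ι F) : MonoidAlgebra K (Matrix ι ι F) :=
  ∑ h, oneSubZero F K (h * g).trace • MonoidAlgebra.of K _ h

/-- As g is injective, a kernel vector v of A gives a rank one N with A N = 0 and tr(N g) = 1.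
Translating h by N makes the sum cancel. -/
theorem traceSum_mem_singularAnn {g : Matrix ι ι F} (hg : g.det ≠ 0) :
    traceSum K g ∈ singularAnn F K ι := by
  intro A hA
  obtain ⟨v, hv0, hv⟩ := Matrix.exists_mulVec_eq_zero_iff.2 hA
  obtain ⟨i, hi⟩ : ∃ i, (g *ᵥ v) i ≠ 0 := by
    by_contra! h
    exact hg (Matrix.exists_mulVec_eq_zero_iff.1 ⟨v, hv0, funext h⟩)
  set N := Matrix.vecMulVec v (Pi.single i ((g *ᵥ v) i)⁻¹)
  have hN : A * N = 0 := by rw [Matrix.mul_vecMulVec, hv, Matrix.zero_vecMulVec]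
  have ht : (N * g).trace = 1 := by
    rw [Matrix.trace_mul_comm, Matrix.mul_vecMulVec, Matrix.trace_vecMulVec]
    simp [mul_inv_cancel₀ hi]
  have key := sum_oneSubZero_smul_eq_zero (K := K) (fun h : Matrix ι ι F => (h * g).trace)
    (fun h => MonoidAlgebra.of K _ (A * h)) N
    (fun h => by simp only [add_mul, Matrix.trace_add, ht])
    (fun h => by simp only [mul_add, hN, add_zero])
  rw [← key, traceSum, Finset.mul_sum]
  exact Finset.sum_congr rfl fun h _ => by rw [mul_smul_comm, ← map_mul]

theorem traceSum_mul_of (g : Matrix ι ι F) (k : (Matrix ι ι F)ˣ) :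
    traceSum K (k.1 * g) * MonoidAlgebra.of K _ k.1 = traceSum K g := by
  simp only [traceSum, Finset.sum_mul, smul_mul_assoc, ← map_mul, ← mul_assoc]
  exact Equiv.sum_comp (Units.mulRight k)
    fun h => oneSubZero F K (h * g).trace • MonoidAlgebra.of K _ h

/-- Under the trace form, only scalar matrices are orthogonal to all traceless ones. -/
theorem exists_trace_eq_one {h : Matrix ι ι F} (hh : ∀ c : F, h ≠ c • (1 : Matrix ι ι F)) :
    ∃ g : Matrix ι ι F, g.trace = 0 ∧ (h * g).trace = 1 := by
  by_contra! H
  have H0 : ∀ g : Matrix ι ι F, g.trace = 0 → (h * g).trace = 0 := by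
    intro g hg
    by_contra h0
    refine H ((h * g).trace⁻¹ • g) (by simp [hg]) ?_
    rw [Matrix.mul_smul, Matrix.trace_smul, smul_eq_mul, inv_mul_cancel₀ h0]
  rcases isEmpty_or_nonempty ι with hι | ⟨⟨i₀⟩⟩
  · exact hh 0 (Subsingleton.elim _ _)
  refine hh (h i₀ i₀) ?_
  ext i j
  -- Testing against this traceless matrix gives h i j = δ_ij h i₀ i₀.
  have := H0 (Matrix.single j i 1 - Matrix.single i₀ i₀ (if i = j then 1 else 0)) (by
    rw [Matrix.trace_sub]
    by_cases hij : i = j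
    · subst hij; simp
    · simp [hij, Matrix.trace_single_eq_of_ne _ _ _ (Ne.symm hij)])
  rw [mul_sub, Matrix.trace_sub, sub_eq_zero, Matrix.trace_mul_single, Matrix.trace_mul_single] at this
  simp at this
  rw [this]
  by_cases hij : i = j <;> simp [hij]

/-- Sum over all g of trace 1, that is, g in E + Z. A nonscalar h gets coefficient 0 by translation
in Z; a scalar a gets |Z| times 1, -1 or 0 according as a = 1, a = 0 or neither. The zero matrix is
singular, so |Z| · 1 remains. -/
theorem natCast_card_mem_singularSup [Nonempty ι]
    (H : ∀ g : Matrix ι ι F, traceSum K g ∈ singularSup F K ι) :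
    (Nat.card (Matrix.traceAddMonoidHom ι F).ker : K) • (1 : MonoidAlgebra K (Matrix ι ι F)) ∈
      singularSup F K ι := by
  classical
  obtain ⟨i₀⟩ := ‹Nonempty ι›
  set E : Matrix ι ι F := Matrix.single i₀ i₀ 1
  have hE : E.trace = 1 := by simp [E]
  set Z := (Matrix.traceAddMonoidHom ι F).ker
  have hZ : ∀ g : Z, g.1.trace = 0 := fun g => g.2
  have h1 : ∑ g : Z, traceSum K (E + g.1) ∈ singularSup F K ι := Submodule.sum_mem _ fun g _ => H _
  set c : Matrix ι ι F → K := fun h => ∑ g : Z, oneSubZero F K (h * (E + g.1)).trace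
  have h2 : ∑ g : Z, traceSum K (E + g.1) = ∑ h, c h • MonoidAlgebra.of K _ h := by
    simp only [traceSum, c, Finset.sum_smul]
    exact Finset.sum_comm
  rw [h2, ← Finset.add_sum_erase _ _ (Finset.mem_univ 1)] at h1
  have hc : ∀ a : F, c (a • 1) = Nat.card Z * oneSubZero F K a := by
    intro a
    simp [c, hE, hZ]
  have h3 : ∑ h ∈ Finset.univ.erase 1, c h • MonoidAlgebra.of K _ h ∈ singularSup F K ι := by
    refine Submodule.sum_mem _ fun h hh => ?_
    have hh1 : h ≠ 1 := Finset.ne_of_mem_erase hh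
    by_cases hs : ∃ a : F, h = a • (1 : Matrix ι ι F)
    · obtain ⟨a, rfl⟩ := hs
      by_cases ha : a = 0
      · refine Submodule.smul_mem _ _ (Submodule.mem_sup_right (of_mem_singularSpan ?_))
        simp [ha, Matrix.det_zero]
      · have ha1 : a ≠ 1 := fun h => hh1 (by rw [h, one_smul])
        rw [hc]
        simp [oneSubZero, ha, ha1]
    · push Not at hs
      obtain ⟨g, hg0, hg1⟩ := exists_trace_eq_one hs
      have : c h = 0 := by
        have := sum_oneSubZero_smul_eq_zero (M := Z) (K := K) (fun g : Z => (h * (E + g.1)).trace)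
          (fun _ => (1 : K)) ⟨g, hg0⟩ (fun g' => by simp [mul_add, hg1, add_assoc]) (fun _ => rfl)
        simpa using this
      rw [this, zero_smul]
      exact zero_mem _
  have h4 := sub_mem h1 h3
  rw [add_sub_cancel_right, map_one, ← one_smul F (1 : Matrix ι ι F), hc] at h4
  simpa [oneSubZero] using h4

theorem isUnit_natCast_card_of_dvd {N : ℕ} {q : ℕ} (hq : IsUnit (q : K)) {k : ℕ} (h : N ∣ q ^ k) :
    IsUnit (N : K) := by
  refine isUnit_of_dvd_unit (Nat.cast_dvd_cast h) ?_
  rw [Nat.cast_pow]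
  exact hq.pow k

variable {κ : Type*} [Fintype κ] [DecidableEq κ]

/-- Each unipotent k in the sum fixes g, whose last row is zero, so right multiplication by k fixes
the trace sum. -/
theorem traceSum_mul_unipotentSum {g : Matrix (κ ⊕ Unit) (κ ⊕ Unit) F}
    (hg : ∀ j, g (Sum.inr ()) j = 0) :
    traceSum K g * unipotentSum F K κ = (Fintype.card F ^ Fintype.card κ : K) • traceSum K g := by
  have key : ∀ u : κ → F, traceSum K g * MonoidAlgebra.of K _ (blockUpper 1 u 1) = traceSum K g := by
    intro u
    have hu : IsUnit (blockUpper (1 : Matrix κ κ F) u 1) := by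
      rw [Matrix.isUnit_iff_isUnit_det, det_blockUpper]
      simp
    obtain ⟨k, hk⟩ := hu
    have : k.1 * g = g := by
      rw [hk]
      ext (i | i) j <;> simp [blockUpper, Matrix.mul_apply, hg, Matrix.one_apply]
    rw [← hk]
    conv_lhs => rw [← this]
    exact traceSum_mul_of g k
  simp only [unipotentSum, Finset.mul_sum, key, Finset.sum_const, Finset.card_univ]
  rw [← Nat.cast_smul_eq_nsmul K]
  simp

theorem one_mem_singularSup_sum {q : ℕ} (hq : Fintype.card F = q) (hqK : IsUnit (q : K))
    (h : (1 : MonoidAlgebra K (Matrix κ κ F)) ∈ singularSup F K κ) :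
    (1 : MonoidAlgebra K (Matrix (κ ⊕ Unit) (κ ⊕ Unit) F)) ∈ singularSup F K (κ ⊕ Unit) := by
  have H : ∀ g : Matrix (κ ⊕ Unit) (κ ⊕ Unit) F, traceSum K g ∈ singularSup F K (κ ⊕ Unit) := by
    intro g
    by_cases hg : g.det = 0
    · obtain ⟨r, hr, hrg⟩ := Matrix.exists_vecMul_eq_zero_iff.2 hg
      obtain ⟨k, hk⟩ := exists_isUnit_row_eq hr
      -- The last row of k is a left kernel vector of g, so the last row of k g is zero.
      rw [← traceSum_mul_of g k]
      refine singularSup_mul_mem _ ?_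
      have h1 := mul_mem_singularSup (traceSum K (k.1 * g)) (unipotentSum_mem_singularSup h)
      rw [traceSum_mul_unipotentSum (fun j => ?_), hq] at h1
      · have h2 := Submodule.smul_mem _ (↑(hqK.pow (Fintype.card κ)).unit⁻¹ : K) h1
        rwa [smul_smul, IsUnit.val_inv_mul, one_smul] at h2
      · rw [Matrix.mul_apply_eq_vecMul, hk, hrg]
        rfl
    · exact Submodule.mem_sup_left (traceSum_mem_singularAnn hg)
  have hN := natCast_card_mem_singularSup H
  have hu : IsUnit (Nat.card (Matrix.traceAddMonoidHom (κ ⊕ Unit) F).ker : K) := by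
    refine isUnit_natCast_card_of_dvd hqK (k := Fintype.card ((κ ⊕ Unit) × (κ ⊕ Unit))) ?_
    convert AddSubgroup.card_addSubgroup_dvd_card (Matrix.traceAddMonoidHom (κ ⊕ Unit) F).ker
    rw [Nat.card_eq_fintype_card, ← hq, ← Fintype.card_fun]
    exact Fintype.card_congr (Equiv.curry _ _ _)
  have h2 := Submodule.smul_mem _ (↑hu.unit⁻¹ : K) hN
  rwa [smul_smul, IsUnit.val_inv_mul, one_smul] at h2

theorem one_mem_singularSup (hqK : IsUnit (Fintype.card F : K)) (n : ℕ) :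
    (1 : MonoidAlgebra K (Matrix (Fin n) (Fin n) F)) ∈ singularSup F K (Fin n) := by
  induction n with
  | zero =>
    -- The empty matrix has determinant 1, so nothing is singular and 1 is in the annihilator.
    refine Submodule.mem_sup_left fun A hA => ?_
    simp at hA
  | succ n ih =>
    exact one_mem_singularSup_of_equiv
      ((Equiv.sumCongr (Equiv.refl _) (Equiv.equivPUnit (Fin 1)).symm).trans finSumFinEquiv)
      (one_mem_singularSup_sum rfl hqK ih)

/-- **Kovács' theorem**: the ideal of the monoid algebra of `M_n(F)` spanned by the singular
matrices has an identity element, namely `1 - x`. -/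
theorem exists_singular_idempotent (hqK : IsUnit (Fintype.card F : K)) (n : ℕ) :
    ∃ x : MonoidAlgebra K (Matrix (Fin n) (Fin n) F),
      (∀ A : Matrix (Fin n) (Fin n) F, A.det = 0 → MonoidAlgebra.of K _ A * x = 0) ∧
      (∀ A : Matrix (Fin n) (Fin n) F, A.det = 0 → x * MonoidAlgebra.of K _ A = 0) ∧
      1 - x ∈ singularSpan F K (Fin n) := by
  obtain ⟨x, hx, s, hs, hxs⟩ := Submodule.mem_sup.1 (one_mem_singularSup hqK n)
  set y := transposeMap K (Fin n) x
  set t := transposeMap K (Fin n) s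
  have hyt : y + t = 1 := by
    rw [← map_add, hxs, ← map_one (MonoidAlgebra.of K _), transposeMap_of, Matrix.transpose_one]
  have hy : ∀ A : Matrix (Fin n) (Fin n) F, A.det = 0 → y * MonoidAlgebra.of K _ A = 0 := by
    intro A hA
    rw [← Matrix.transpose_transpose A, ← transposeMap_of_mul,
      hx _ (by rwa [Matrix.det_transpose]), map_zero]
  have hys : ∀ s ∈ singularSpan F K (Fin n), y * s = 0 := by
    intro s hs
    induction hs using Submodule.span_induction with
    | mem z hz =>
      obtain ⟨A, hA, rfl⟩ := hz
      exact hy A hA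
    | zero => simp
    | add z w _ _ hz hw => rw [mul_add, hz, hw, add_zero]
    | smul a z _ hz => rw [mul_smul_comm, hz, smul_zero]
  -- A left and a right annihilator, each congruent to 1 modulo the span, both equal y * x.
  have hxy : y = x := by
    calc y = y * (x + s) := by rw [hxs, mul_one]
      _ = (y + t) * x := by
        rw [mul_add, hys s hs, add_zero, add_mul,
          singularSpan_mul_singularAnn (transposeMap_mem_singularSpan hs) hx, add_zero]
      _ = x := by rw [hyt, one_mul]
  exact ⟨x, hx, hxy ▸ hy, by rwa [← hxs, add_sub_cancel_left]⟩

end Kovacs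

/-! ### Linear maps between the spaces F^n and singular matrices -/

section Hom

variable {F : Type u} [Field F]

/-- The space `F^n`, as an object of the category of finite-dimensional vector spaces. -/
abbrev fnSpace (F : Type u) [Field F] (n : ℕ) : FGModuleCat.{u} F := FGModuleCat.of F (Fin n → F)

/-- The endomorphism of `F^n` given by a matrix. -/
abbrev matHom {n : ℕ} (A : Matrix (Fin n) (Fin n) F) : fnSpace F n ⟶ fnSpace F n :=
  FGModuleCat.ofHom (Matrix.toLin' A)

theorem matHom_one (n : ℕ) : matHom (1 : Matrix (Fin n) (Fin n) F) = 𝟙 _ := by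
  rw [matHom, Matrix.toLin'_one]
  rfl

theorem matHom_mul {n : ℕ} (A B : Matrix (Fin n) (Fin n) F) :
    matHom (A * B) = matHom B ≫ matHom A := by
  rw [matHom, Matrix.toLin'_mul]
  rfl

theorem exists_matHom_eq {n : ℕ} (s : fnSpace F n ⟶ fnSpace F n) : ∃ A, matHom A = s :=
  ⟨LinearMap.toMatrix' s.hom.hom, by
    ext : 1
    exact Matrix.toLin'_toMatrix' _⟩

/-- For dimension reasons s kills some v ≠ 0; take the projection with kernel the line of v. -/
theorem exists_singular_matHom_comp {m n : ℕ} (h : n < m) (s : fnSpace F m ⟶ fnSpace F n) :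
    ∃ A : Matrix (Fin m) (Fin m) F, A.det = 0 ∧ matHom A ≫ s = s := by
  obtain ⟨v, hv, hv0⟩ : ∃ v ∈ LinearMap.ker s.hom.hom, v ≠ 0 := by
    refine Submodule.exists_mem_ne_zero_of_ne_bot (LinearMap.ker_ne_bot_of_finrank_lt ?_)
    simpa using h
  obtain ⟨i, hi⟩ := Function.ne_iff.1 hv0
  refine ⟨1 - Matrix.vecMulVec v (Pi.single i (v i)⁻¹), ?_, ?_⟩
  · refine Matrix.exists_mulVec_eq_zero_iff.1 ⟨v, hv0, ?_⟩
    rw [Matrix.sub_mulVec, Matrix.one_mulVec, Matrix.vecMulVec_mulVec]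
    ext j
    simp [inv_mul_cancel₀ hi]
  · ext : 1
    refine LinearMap.ext fun x => ?_
    change s.hom.hom (Matrix.toLin' _ x) = s.hom.hom x
    rw [Matrix.toLin'_apply, Matrix.sub_mulVec, Matrix.one_mulVec, Matrix.vecMulVec_mulVec, map_sub,
      op_smul_eq_smul, map_smul, LinearMap.mem_ker.1 hv, smul_zero, sub_zero]

/-- The range of s lies in the kernel of some form f ≠ 0; with f v = 1, project onto that kernel
along v. -/
theorem exists_comp_singular_matHom {m n : ℕ} (h : m < n) (s : fnSpace F m ⟶ fnSpace F n) :
    ∃ A : Matrix (Fin n) (Fin n) F, A.det = 0 ∧ s ≫ matHom A = s := by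
  obtain ⟨f, hf0, hf⟩ := Submodule.exists_le_ker_of_lt_top (LinearMap.range s.hom.hom) (by
    rw [lt_top_iff_ne_top]
    intro ht
    have h1 := LinearMap.finrank_range_le s.hom.hom
    rw [ht, finrank_top] at h1
    simp at h1
    omega)
  obtain ⟨v, hv⟩ : ∃ v, f v = 1 := LinearMap.surjective hf0 1
  have key : ∀ x, f x = (fun j => f (Pi.single j 1)) ⬝ᵥ x := by
    intro x
    conv_lhs => rw [LinearMap.pi_apply_eq_sum_univ f x]
    have h1 : ∀ i : Fin n, (fun j => if i = j then (1 : F) else 0) = Pi.single i 1 := fun i => by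
      ext j
      simp [Pi.single_apply, eq_comm]
    simp only [h1, dotProduct, smul_eq_mul, mul_comm]
  refine ⟨1 - Matrix.vecMulVec v (fun j => f (Pi.single j 1)), ?_, ?_⟩
  · refine Matrix.exists_mulVec_eq_zero_iff.1 ⟨v, fun h0 => by simp [h0] at hv, ?_⟩
    rw [Matrix.sub_mulVec, Matrix.one_mulVec, Matrix.vecMulVec_mulVec, ← key, hv]
    simp
  · ext : 1
    refine LinearMap.ext fun x => ?_
    change Matrix.toLin' _ (s.hom.hom x) = s.hom.hom x
    rw [Matrix.toLin'_apply, Matrix.sub_mulVec, Matrix.one_mulVec, Matrix.vecMulVec_mulVec, ← key,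
      LinearMap.mem_ker.1 (hf ⟨x, rfl⟩)]
    simp

/-- The factorization through the range of A, in coordinates; it drives the inductions on n for the
unit. -/
theorem exists_matHom_factor {n : ℕ} {A : Matrix (Fin n) (Fin n) F} (hA : A.det = 0) :
    ∃ m < n, ∃ (b : fnSpace F n ⟶ fnSpace F m) (a : fnSpace F m ⟶ fnSpace F n),
      matHom A = b ≫ a := by
  set R := LinearMap.range (Matrix.toLin' A)
  have hlt : Module.finrank F R < n := by
    refine lt_of_le_of_ne ?_ fun h => ?_
    · simpa using LinearMap.finrank_range_le (Matrix.toLin' A)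
    · have h1 : R = ⊤ := Submodule.eq_top_of_finrank_eq (by simpa using h)
      have h2 := (Matrix.toLin' A).isUnit_iff_range_eq_top.2 h1
      have h3 := LinearMap.isUnit_det _ h2
      rw [LinearMap.det_toLin', hA] at h3
      exact not_isUnit_zero h3
  set e := (Module.finBasis F R).equivFun
  refine ⟨_, hlt, FGModuleCat.ofHom (e.toLinearMap ∘ₗ (Matrix.toLin' A).rangeRestrict),
    FGModuleCat.ofHom (R.subtype ∘ₗ e.symm.toLinearMap), ?_⟩
  ext : 1
  refine LinearMap.ext fun x => ?_
  change Matrix.toLin' A x = (e.symm (e ((Matrix.toLin' A).rangeRestrict x)) : Fin n → F)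
  rw [e.symm_apply_apply]
  rfl

/-- Finite Hom sets are small in every universe, which lets `Shrink` keep the families in the
universe of the modules. -/
instance finite_fgModuleCat_hom [Finite F] (V W : FGModuleCat.{u} F) : Finite (V ⟶ W) :=
  Module.finite_of_finite F

end Hom

/-! ### The inverse functor -/

section Inverse

variable {F : Type u} [Field F] [Finite F] {K : Type v} [CommRing K]

/-- The families of functions on the sets `Hom(V, F^n)` with values in `M n` which are compatible
with the action of `GL_n(F)` and vanish on the homomorphisms that are not surjective. -/
def surjFamilies (M : ProdGLModules.{u, v, w} F K) (V : FGModuleCat.{u} F) :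
    Submodule K (∀ n, Shrink.{w} (V ⟶ fnSpace F n) → M n) where
  carrier := {h |
    (∀ (n : ℕ) (s : V ⟶ fnSpace F n) (A : Matrix (Fin n) (Fin n) F), A.det = 0 →
      h n (equivShrink _ (s ≫ matHom A)) = 0) ∧
    ∀ (n : ℕ) (s : V ⟶ fnSpace F n) (g : Matrix.GeneralLinearGroup (Fin n) F),
      h n (equivShrink _ (s ≫ matHom g.1)) = MonoidAlgebra.of K _ g • h n (equivShrink _ s)}
  add_mem' hx hy := ⟨fun n s A hA => by
    rw [Pi.add_apply, Pi.add_apply, hx.1 n s A hA, hy.1 n s A hA, add_zero],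
    fun n s g => by simp only [Pi.add_apply, hx.2, hy.2, smul_add]⟩
  zero_mem' := ⟨fun _ _ _ _ => rfl, fun _ _ _ => (smul_zero _).symm⟩
  smul_mem' c h hh := ⟨fun n s A hA => by
    rw [Pi.smul_apply, Pi.smul_apply, hh.1 n s A hA, smul_zero],
    fun n s g => by
      change c • h n _ = _ • c • h n _
      rw [hh.2, smul_comm]⟩

namespace surjFamilies

variable {M : ProdGLModules.{u, v, w} F K} {V W : FGModuleCat.{u} F}

/-- Evaluation of a family at a homomorphism. -/
def eval (n : ℕ) (s : V ⟶ fnSpace F n) : surjFamilies M V →ₗ[K] M n where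
  toFun h := h.1 n (equivShrink _ s)
  map_add' _ _ := rfl
  map_smul' _ _ := rfl

theorem ext_eval {h h' : surjFamilies M V} (H : ∀ n s, eval n s h = eval n s h') : h = h' := by
  refine Subtype.ext (funext fun n => funext fun s => ?_)
  simpa [eval] using H n ((equivShrink _).symm s)

theorem eval_comp_singular (h : surjFamilies M V) {n : ℕ} (s : V ⟶ fnSpace F n)
    {A : Matrix (Fin n) (Fin n) F} (hA : A.det = 0) : eval n (s ≫ matHom A) h = 0 :=
  h.2.1 n s A hA

theorem eval_comp_unit (h : surjFamilies M V) {n : ℕ} (s : V ⟶ fnSpace F n)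
    (g : Matrix.GeneralLinearGroup (Fin n) F) :
    eval n (s ≫ matHom g.1) h = MonoidAlgebra.of K _ g • eval n s h :=
  h.2.2 n s g

/-- The family with prescribed values. -/
def mk (h : ∀ n, (V ⟶ fnSpace F n) → M n)
    (h₁ : ∀ (n : ℕ) (s : V ⟶ fnSpace F n) (A : Matrix (Fin n) (Fin n) F), A.det = 0 →
      h n (s ≫ matHom A) = 0)
    (h₂ : ∀ (n : ℕ) (s : V ⟶ fnSpace F n) (g : Matrix.GeneralLinearGroup (Fin n) F),
      h n (s ≫ matHom g.1) = MonoidAlgebra.of K _ g • h n s) : surjFamilies M V :=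
  ⟨fun n s => h n ((equivShrink _).symm s),
    fun n s A hA => by simpa using h₁ n s A hA, fun n s g => by simpa using h₂ n s g⟩

@[simp]
theorem eval_mk (h : ∀ n, (V ⟶ fnSpace F n) → M n) (h₁ h₂) (n : ℕ) (s : V ⟶ fnSpace F n) :
    eval n s (mk h h₁ h₂) = h n s := by
  simp [eval, mk]

/-- The functoriality of families in the vector space. -/
def map (c : V ⟶ W) : surjFamilies M V →ₗ[K] surjFamilies M W where
  toFun h := mk (fun n s => eval n (c ≫ s) h)
    (fun n s A hA => by rw [← Category.assoc, eval_comp_singular _ _ hA])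
    (fun n s g => by rw [← Category.assoc, eval_comp_unit])
  map_add' h h' := ext_eval fun n s => by simp
  map_smul' a h := ext_eval fun n s => by simp

@[simp]
theorem eval_map (c : V ⟶ W) (h : surjFamilies M V) (n : ℕ) (s : W ⟶ fnSpace F n) :
    eval n s (map c h) = eval n (c ≫ s) h := by
  simp [map]

/-- The functoriality of families in the modules of values. -/
def mapCoeff {M' : ProdGLModules.{u, v, w} F K} (φ : M ⟶ M') :
    surjFamilies M V →ₗ[K] surjFamilies M' V where
  toFun h := mk (fun n s => (φ n).hom (eval n s h))
    (fun n s A hA => by rw [eval_comp_singular _ _ hA, map_zero])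
    (fun n s g => by rw [eval_comp_unit, map_smul])
  map_add' h h' := ext_eval fun n s => by simp
  map_smul' a h := ext_eval fun n s => by
    simp only [eval_mk, map_smul, RingHom.id_apply]
    exact (φ n).hom.map_smul (algebraMap K _ a) _

@[simp]
theorem eval_mapCoeff {M' : ProdGLModules.{u, v, w} F K} (φ : M ⟶ M') (h : surjFamilies M V)
    (n : ℕ) (s : V ⟶ fnSpace F n) : eval n s (mapCoeff φ h) = (φ n).hom (eval n s h) := by
  simp [mapCoeff]

end surjFamilies

variable (F K) in
/-- The functor sending a family of `K[GL_n(F)]`-modules to the generic representation of the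
equivariant families of functions on surjections. -/
def surjFamiliesFunctor : ProdGLModules.{u, v, w} F K ⥤ GenericRep.{u, v, w} F K where
  obj M :=
    { obj := fun V => ModuleCat.of K (surjFamilies M V)
      map := fun c => ModuleCat.ofHom (surjFamilies.map c)
      map_id := fun V => by
        refine ModuleCat.hom_ext (LinearMap.ext fun h => surjFamilies.ext_eval fun n s => ?_)
        simp
      map_comp := fun c d => by
        refine ModuleCat.hom_ext (LinearMap.ext fun h => surjFamilies.ext_eval fun n s => ?_)
        simp }
  map φ :=
    { app := fun V => ModuleCat.ofHom (surjFamilies.mapCoeff φ)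
      naturality := fun V W c => by
        refine ModuleCat.hom_ext (LinearMap.ext fun h => surjFamilies.ext_eval fun n s => ?_)
        simp }
  map_id M := by
    refine NatTrans.ext (funext fun V =>
      ModuleCat.hom_ext (LinearMap.ext fun h => surjFamilies.ext_eval fun n s => ?_))
    simp
  map_comp φ ψ := by
    refine NatTrans.ext (funext fun V =>
      ModuleCat.hom_ext (LinearMap.ext fun h => surjFamilies.ext_eval fun n s => ?_))
    simp

end Inverse

/-! ### Pure parts and the projections onto them -/

section PurePart

variable {F : Type u} [Field F] {K : Type v} [CommRing K]

/-- An element of the pure part, regarded as an element of the module over the group algebra. -/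
def pureMk {G : GenericRep.{u, v, w} F K} {n : ℕ} (x : G.obj (fnSpace F n))
    (hx : x ∈ G.purePart n) : (purePartFunctor F K n).obj G :=
  (G.pureRep n).asModuleEquiv.symm ⟨x, hx⟩

/-- The underlying element of an element of the pure part. -/
def pureVal (G : GenericRep.{u, v, w} F K) (n : ℕ) :
    (purePartFunctor F K n).obj G →ₗ[K] G.obj (fnSpace F n) where
  toFun y := ((G.pureRep n).asModuleEquiv y).1
  map_add' _ _ := rfl
  map_smul' c y := by
    have h := (G.pureRep n).asModuleEquiv_map_smul (algebraMap K _ c) y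
    rw [AlgHom.commutes] at h
    exact congrArg Subtype.val h

variable {G H : GenericRep.{u, v, w} F K} {n : ℕ}

theorem pureVal_injective : Function.Injective (pureVal G n) := fun _ _ h => Subtype.ext h

theorem pureVal_mem (y : (purePartFunctor F K n).obj G) : pureVal G n y ∈ G.purePart n :=
  ((G.pureRep n).asModuleEquiv y).2

@[simp]
theorem pureVal_of_smul (g : Matrix.GeneralLinearGroup (Fin n) F)
    (y : (purePartFunctor F K n).obj G) :
    pureVal G n (MonoidAlgebra.of K _ g • y) = G.matrixRep n g.1 (pureVal G n y) := by
  have h := (G.pureRep n).asModuleEquiv_map_smul (MonoidAlgebra.of K _ g) y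
  rw [Representation.asAlgebraHom_of] at h
  exact congrArg Subtype.val h

@[simp]
theorem pureVal_map (f : G ⟶ H) (y : (purePartFunctor F K n).obj G) :
    pureVal H n (((purePartFunctor F K n).map f).hom y) = (f.app _).hom (pureVal G n y) := rfl

theorem GenericRep.matrixRep_map (f : G ⟶ H) (A : Matrix (Fin n) (Fin n) F)
    (x : G.obj (fnSpace F n)) :
    H.matrixRep n A ((f.app _).hom x) = (f.app _).hom (G.matrixRep n A x) :=
  (NatTrans.naturality_apply f (matHom A) x).symm

theorem GenericRep.asAlgebraHom_matrixRep_map (f : G ⟶ H)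
    (r : MonoidAlgebra K (Matrix (Fin n) (Fin n) F)) (x : G.obj (fnSpace F n)) :
    (H.matrixRep n).asAlgebraHom r ((f.app _).hom x) =
      (f.app _).hom ((G.matrixRep n).asAlgebraHom r x) := by
  induction r using MonoidAlgebra.induction_on with
  | of A => simp only [Representation.asAlgebraHom_of, GenericRep.matrixRep_map]
  | add a b ha hb => simp only [map_add, LinearMap.add_apply, ha, hb]
  | smul c a ha => simp only [map_smul, LinearMap.smul_apply, ha]

theorem asAlgebraHom_mem_of_mem_singularSpan {V : Type*} [AddCommGroup V] [Module K V]
    (ρ : Representation K (Matrix (Fin n) (Fin n) F) V) (N : Submodule K V) {x : V}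
    (hx : ∀ A : Matrix (Fin n) (Fin n) F, A.det = 0 → ρ A x ∈ N)
    {r : MonoidAlgebra K (Matrix (Fin n) (Fin n) F)} (hr : r ∈ singularSpan F K (Fin n)) :
    ρ.asAlgebraHom r x ∈ N := by
  induction hr using Submodule.span_induction with
  | mem y hy =>
    obtain ⟨A, hA, rfl⟩ := hy
    rw [Representation.asAlgebraHom_of]
    exact hx A hA
  | zero => simp
  | add y z _ _ hy hz => rw [map_add, LinearMap.add_apply]; exact add_mem hy hz
  | smul a y _ hy => rw [map_smul, LinearMap.smul_apply]; exact Submodule.smul_mem _ _ hy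

variable (F K n) in
/-- An idempotent complementary to the span of the singular matrices. -/
structure KovacsIdempotent where
  /-- The element of the monoid algebra. -/
  val : MonoidAlgebra K (Matrix (Fin n) (Fin n) F)
  of_mul : ∀ A : Matrix (Fin n) (Fin n) F, A.det = 0 → MonoidAlgebra.of K _ A * val = 0
  mul_of : ∀ A : Matrix (Fin n) (Fin n) F, A.det = 0 → val * MonoidAlgebra.of K _ A = 0
  one_sub_mem : 1 - val ∈ singularSpan F K (Fin n)

theorem KovacsIdempotent.mul_singularSpan (e : KovacsIdempotent F K n)
    {s : MonoidAlgebra K (Matrix (Fin n) (Fin n) F)} (hs : s ∈ singularSpan F K (Fin n)) :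
    e.val * s = 0 := by
  induction hs using Submodule.span_induction with
  | mem z hz =>
    obtain ⟨A, hA, rfl⟩ := hz
    exact e.mul_of A hA
  | zero => simp
  | add z w _ _ hz hw => rw [mul_add, hz, hw, add_zero]
  | smul a z _ hz => rw [mul_smul_comm, hz, smul_zero]

/-- Both sides equal e r e, as 1 - e lies in a two-sided ideal that e kills on both sides. -/
theorem KovacsIdempotent.commute (e : KovacsIdempotent F K n)
    (r : MonoidAlgebra K (Matrix (Fin n) (Fin n) F)) : e.val * r = r * e.val := by
  have h1 := e.mul_singularSpan (mul_mem_singularSpan r e.one_sub_mem)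
  have h2 := singularSpan_mul_singularAnn (singularSpan_mul_mem r e.one_sub_mem) e.of_mul
  rw [mul_sub, mul_one, mul_sub, sub_eq_zero] at h1
  rw [sub_mul, one_mul, sub_mul, sub_eq_zero] at h2
  exact h1.trans ((mul_assoc _ _ _).symm.trans h2.symm)

/-- The projection onto the pure part. -/
def KovacsIdempotent.proj (e : KovacsIdempotent F K n) (G : GenericRep.{u, v, w} F K) :
    G.obj (fnSpace F n) →ₗ[K] G.obj (fnSpace F n) :=
  (G.matrixRep n).asAlgebraHom e.val

namespace KovacsIdempotent

variable (e : KovacsIdempotent F K n)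

theorem proj_mem (x : G.obj (fnSpace F n)) : e.proj G x ∈ G.purePart n := by
  rw [GenericRep.mem_purePart]
  intro A hA
  rw [proj, ← Representation.asAlgebraHom_of, ← Module.End.mul_apply, ← map_mul, e.of_mul A hA,
    map_zero, LinearMap.zero_apply]

/-- Since 1 - e is a combination of singular matrices, (1 - e) x is one of the images A x. -/
theorem sub_proj_mem (N : Submodule K (G.obj (fnSpace F n))) {x : G.obj (fnSpace F n)}
    (hx : ∀ A : Matrix (Fin n) (Fin n) F, A.det = 0 → G.matrixRep n A x ∈ N) :
    x - e.proj G x ∈ N := by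
  have := asAlgebraHom_mem_of_mem_singularSpan (G.matrixRep n) N hx e.one_sub_mem
  rwa [map_sub, map_one] at this

theorem proj_of_mem {x : G.obj (fnSpace F n)} (hx : x ∈ G.purePart n) : e.proj G x = x := by
  have := e.sub_proj_mem (x := x) ⊥ fun A hA => by
    rw [GenericRep.mem_purePart.1 hx A hA]
    exact zero_mem _
  exact (sub_eq_zero.1 this).symm

theorem proj_singular {A : Matrix (Fin n) (Fin n) F} (hA : A.det = 0) (x : G.obj (fnSpace F n)) :
    e.proj G (G.matrixRep n A x) = 0 := by
  rw [proj, ← Representation.asAlgebraHom_of, ← Module.End.mul_apply, ← map_mul, e.mul_of A hA,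
    map_zero, LinearMap.zero_apply]

theorem proj_matrixRep (A : Matrix (Fin n) (Fin n) F) (x : G.obj (fnSpace F n)) :
    e.proj G (G.matrixRep n A x) = G.matrixRep n A (e.proj G x) := by
  rw [proj, ← Representation.asAlgebraHom_of, ← Module.End.mul_apply, ← map_mul, e.commute,
    map_mul, Module.End.mul_apply]

theorem proj_map (f : G ⟶ H) (x : G.obj (fnSpace F n)) :
    e.proj H ((f.app _).hom x) = (f.app _).hom (e.proj G x) :=
  GenericRep.asAlgebraHom_matrixRep_map f _ x

end KovacsIdempotent

end PurePart

section PureParts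

variable {F : Type u} [Field F] {K : Type v} [CommRing K]

/-- The family of all pure parts of a generic representation. -/
abbrev pureParts (G : GenericRep.{u, v, w} F K) : ProdGLModules.{u, v, w} F K :=
  fun n => (purePartFunctor F K n).obj G

variable (e : ∀ n, KovacsIdempotent F K n)

/-- The element of the pure part of `G(F^n)` obtained from `x` by applying `G(s)` and projecting. -/
def toPure (G : GenericRep.{u, v, w} F K) {V : FGModuleCat.{u} F} (n : ℕ) (s : V ⟶ fnSpace F n)
    (x : G.obj V) : (purePartFunctor F K n).obj G :=
  pureMk ((e n).proj G ((G.map s).hom x)) ((e n).proj_mem _)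

@[simp]
theorem pureVal_toPure (G : GenericRep.{u, v, w} F K) {V : FGModuleCat.{u} F} (n : ℕ)
    (s : V ⟶ fnSpace F n) (x : G.obj V) :
    pureVal G n (toPure e G n s x) = (e n).proj G ((G.map s).hom x) := rfl

end PureParts

/-! ### The unit: bijectivity by induction on dimension -/

section Unit

variable {F : Type u} [Field F] [Finite F] {K : Type v} [CommRing K]

variable (e : ∀ n, KovacsIdempotent F K n)

/-- The family of functions on surjections attached to an element of a generic representation. -/
def toFamily (G : GenericRep.{u, v, w} F K) (V : FGModuleCat.{u} F) (x : G.obj V) :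
    surjFamilies (pureParts G) V :=
  surjFamilies.mk (fun n s => toPure e G n s x)
    (fun n s A hA => pureVal_injective <| by
      rw [pureVal_toPure, G.map_comp, map_zero]
      exact (e n).proj_singular hA _)
    (fun n s g => pureVal_injective <| by
      rw [pureVal_toPure, G.map_comp]
      exact ((e n).proj_matrixRep g.1 _).trans (pureVal_of_smul g (toPure e G n s x)).symm)

@[simp]
theorem eval_toFamily (G : GenericRep.{u, v, w} F K) {V : FGModuleCat.{u} F} (n : ℕ)
    (s : V ⟶ fnSpace F n) (x : G.obj V) :
    surjFamilies.eval n s (toFamily e G V x) = toPure e G n s x := by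
  rw [toFamily, surjFamilies.eval_mk]

/-- The linear map sending an element of a generic representation to its family. -/
def toFamilies (G : GenericRep.{u, v, w} F K) (V : FGModuleCat.{u} F) :
    G.obj V →ₗ[K] surjFamilies (pureParts G) V where
  toFun := toFamily e G V
  map_add' x y := surjFamilies.ext_eval fun n s => by
    rw [map_add, eval_toFamily, eval_toFamily, eval_toFamily]
    exact pureVal_injective (by simp only [map_add, pureVal_toPure])
  map_smul' c x := surjFamilies.ext_eval fun n s => by
    rw [map_smul, eval_toFamily, eval_toFamily]
    refine pureVal_injective ?_
    rw [RingHom.id_apply]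
    refine Eq.trans ?_ ((pureVal G n).map_smul c (toPure e G n s x)).symm
    simp only [map_smul, pureVal_toPure]

@[simp]
theorem pureVal_eval_toFamilies (G : GenericRep.{u, v, w} F K) {V : FGModuleCat.{u} F} (n : ℕ)
    (s : V ⟶ fnSpace F n) (x : G.obj V) :
    pureVal G n (surjFamilies.eval n s (toFamilies e G V x)) = (e n).proj G ((G.map s).hom x) :=
  congrArg (pureVal G n) (eval_toFamily e G n s x)

/-- Families over `pureParts` agree when the underlying values agree. -/
theorem surjFamilies_ext_pureVal {G : GenericRep.{u, v, w} F K} {V : FGModuleCat.{u} F}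
    {h h' : surjFamilies (pureParts G) V}
    (H : ∀ n s, pureVal G n (surjFamilies.eval n s h) = pureVal G n (surjFamilies.eval n s h')) :
    h = h' :=
  surjFamilies.ext_eval fun n s => pureVal_injective (H n s)

theorem toFamilies_map (G : GenericRep.{u, v, w} F K) {V W : FGModuleCat.{u} F} (c : V ⟶ W)
    (x : G.obj V) :
    toFamilies e G W ((G.map c).hom x) = surjFamilies.map c (toFamilies e G V x) :=
  surjFamilies_ext_pureVal fun n s => by simp

/-- A pure element of a representation by families on `F^n` is determined by its component in
degree `n`. -/
theorem surjFamilies.eval_eq_zero_of_mem_purePart {M : ProdGLModules.{u, v, w} F K} {m : ℕ}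
    {h : surjFamilies M (fnSpace F m)}
    (hh : h ∈ GenericRep.purePart ((surjFamiliesFunctor F K).obj M) m) {n : ℕ} (hn : n ≠ m)
    (s : fnSpace F m ⟶ fnSpace F n) : surjFamilies.eval n s h = 0 := by
  rcases lt_or_gt_of_ne hn with hlt | hlt
  · obtain ⟨A, hA, hs⟩ := exists_singular_matHom_comp hlt s
    have h1 : surjFamilies.map (matHom A) h = 0 := GenericRep.mem_purePart.1 hh A hA
    rw [← hs, ← surjFamilies.eval_map, h1, map_zero]
  · obtain ⟨A, hA, hs⟩ := exists_comp_singular_matHom hlt s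
    rw [← hs, surjFamilies.eval_comp_singular _ _ hA]

/-- An endomorphism of F^n is either singular, where families vanish, or in GL_n, where equivariance
reduces to the identity. -/
theorem surjFamilies.eq_zero_of_eval_id {M : ProdGLModules.{u, v, w} F K} {n : ℕ}
    {h : surjFamilies M (fnSpace F n)} (h0 : surjFamilies.eval n (𝟙 _) h = 0)
    (s : fnSpace F n ⟶ fnSpace F n) : surjFamilies.eval n s h = 0 := by
  obtain ⟨A, rfl⟩ := exists_matHom_eq s
  rw [← Category.id_comp (matHom A)]
  by_cases hA : A.det = 0
  · exact surjFamilies.eval_comp_singular _ _ hA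
  · have := surjFamilies.eval_comp_unit h (𝟙 _) (Matrix.GeneralLinearGroup.mkOfDetNeZero A hA)
    rwa [h0, smul_zero] at this

/-- A family vanishing in degree n has zero pure projection, so it is a combination of its images
under singular matrices. -/
theorem surjFamilies.mem_of_eval_eq_zero (e : ∀ n, KovacsIdempotent F K n)
    {M : ProdGLModules.{u, v, w} F K} {n : ℕ}
    {h : surjFamilies M (fnSpace F n)} (h0 : ∀ s, surjFamilies.eval n s h = 0)
    (N : Submodule K (surjFamilies M (fnSpace F n)))
    (hN : ∀ A : Matrix (Fin n) (Fin n) F, A.det = 0 → surjFamilies.map (matHom A) h ∈ N) :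
    h ∈ N := by
  obtain ⟨y, hy⟩ : ∃ y : surjFamilies M (fnSpace F n),
      (e n).proj ((surjFamiliesFunctor F K).obj M) h = y := ⟨_, rfl⟩
  have hmem : ∀ N : Submodule K (surjFamilies M (fnSpace F n)),
      (∀ A : Matrix (Fin n) (Fin n) F, A.det = 0 → surjFamilies.map (matHom A) h ∈ N) →
        h - y ∈ N := fun N hN => by
    rw [← hy]
    exact (e n).sub_proj_mem (G := (surjFamiliesFunctor F K).obj M) N hN
  have hy0 : y = 0 := by
    refine surjFamilies.ext_eval fun m s => ?_
    rw [map_zero]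
    -- In degree n, both h and h - y vanish, the latter being a combination of singular images of h.
    -- In other degrees y vanishes because it is pure.
    by_cases hm : m = n
    · subst hm
      have := hmem (LinearMap.ker (surjFamilies.eval m s)) fun A _ => by
        rw [LinearMap.mem_ker, surjFamilies.eval_map, h0]
      rwa [LinearMap.mem_ker, map_sub, h0, zero_sub, neg_eq_zero] at this
    · refine surjFamilies.eval_eq_zero_of_mem_purePart ?_ hm s
      rw [← hy]
      exact (e n).proj_mem _
  have := hmem N hN
  rwa [hy0, sub_zero] at this

/-- By induction, singular maps, which factor through smaller spaces, kill x. So x is pure, hence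
equal to its value at the identity, which is 0. -/
theorem toFamilies_injective (G : GenericRep.{u, v, w} F K) (n : ℕ) :
    Function.Injective (toFamilies e G (fnSpace F n)) := by
  induction n using Nat.strong_induction_on with
  | _ n ih =>
    rw [injective_iff_map_eq_zero]
    intro x hx
    have hpure : x ∈ G.purePart n := by
      rw [GenericRep.mem_purePart]
      intro A hA
      obtain ⟨m, hm, b, a, hab⟩ := exists_matHom_factor hA
      have h1 : (G.map b).hom x = 0 := by
        refine (injective_iff_map_eq_zero _).1 (ih m hm) _ ?_
        rw [toFamilies_map, hx, map_zero]
      change (G.map (matHom A)).hom x = 0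
      rw [hab, G.map_comp]
      change (G.map a).hom ((G.map b).hom x) = 0
      rw [h1, map_zero]
    have h2 := pureVal_eval_toFamilies e G n (𝟙 (fnSpace F n)) x
    rw [hx, map_zero, map_zero, G.map_id] at h2
    rw [← (e n).proj_of_mem hpure]
    exact h2.symm

theorem toFamilies_surjective (G : GenericRep.{u, v, w} F K) (n : ℕ) :
    Function.Surjective (toFamilies e G (fnSpace F n)) := by
  induction n using Nat.strong_induction_on with
  | _ n ih =>
    -- The value of h at the identity is a pure x, and the family of x has the same value there;
    -- subtracting it reduces to value 0.
    suffices H : ∀ h : surjFamilies (pureParts G) (fnSpace F n),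
        surjFamilies.eval n (𝟙 _) h = 0 → h ∈ LinearMap.range (toFamilies e G (fnSpace F n)) by
      intro h
      set x := pureVal G n (surjFamilies.eval n (𝟙 _) h)
      obtain ⟨y, hy⟩ := H (h - toFamilies e G _ x) (by
        rw [map_sub, sub_eq_zero]
        refine pureVal_injective (G := G) ?_
        rw [pureVal_eval_toFamilies, G.map_id]
        exact ((e n).proj_of_mem (pureVal_mem _)).symm)
      exact ⟨y + x, by rw [map_add, hy, sub_add_cancel]⟩
    intro h h0
    refine surjFamilies.mem_of_eval_eq_zero e
      (surjFamilies.eq_zero_of_eval_id h0) _ fun A hA => ?_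
    obtain ⟨m, hm, b, a, hab⟩ := exists_matHom_factor hA
    obtain ⟨y, hy⟩ := ih m hm (surjFamilies.map b h)
    refine ⟨(G.map a).hom y, ?_⟩
    rw [toFamilies_map, hy, hab]
    exact surjFamilies.ext_eval fun n s => by simp

/-- The transformation from a generic representation to the families on surjections. -/
def toFamiliesHom (G : GenericRep.{u, v, w} F K) :
    G ⟶ (surjFamiliesFunctor F K).obj (pureParts G) where
  app V := ModuleCat.ofHom (toFamilies e G V)
  naturality _ _ c := ModuleCat.hom_ext (LinearMap.ext fun x => toFamilies_map e G c x)

end Unit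

/-! ### Equivariant functions supported on GL_n -/

section UnitExtend

variable {F : Type u} [Field F] {K : Type v} [CommRing K]

theorem map_smul_of_map_of_smul {n : ℕ} {M : Type*} [AddCommGroup M]
    [Module (MonoidAlgebra K (Matrix.GeneralLinearGroup (Fin n) F)) M] {N : Type*} [AddCommGroup N]
    [Module (MonoidAlgebra K (Matrix.GeneralLinearGroup (Fin n) F)) N] (f : M →+ N)
    (hf : ∀ (c : K) x, f (algebraMap K (MonoidAlgebra K (Matrix.GeneralLinearGroup (Fin n) F)) c • x) =
      algebraMap K (MonoidAlgebra K (Matrix.GeneralLinearGroup (Fin n) F)) c • f x)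
    (hg : ∀ g x, f (MonoidAlgebra.of K (Matrix.GeneralLinearGroup (Fin n) F) g • x) =
      MonoidAlgebra.of K (Matrix.GeneralLinearGroup (Fin n) F) g • f x)
    (r : MonoidAlgebra K (Matrix.GeneralLinearGroup (Fin n) F)) (x : M) : f (r • x) = r • f x := by
  induction r using MonoidAlgebra.induction_on with
  | of g => exact hg g x
  | add a b ha hb => rw [add_smul, add_smul, map_add, ha, hb]
  | smul c a ha => rw [Algebra.smul_def, mul_smul, mul_smul, hf, ha]

open Classical in
/-- The value at an endomorphism of `F^n` of the equivariant function supported on `GL_n(F)` with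
value `y` at the identity. -/
def unitExtend {n : ℕ} {M : Type*} [AddCommGroup M]
    [Module (MonoidAlgebra K (Matrix.GeneralLinearGroup (Fin n) F)) M] (y : M)
    (s : fnSpace F n ⟶ fnSpace F n) : M :=
  if h : (LinearMap.toMatrix' s.hom.hom).det = 0 then 0 else
    MonoidAlgebra.of K _ (Matrix.GeneralLinearGroup.mkOfDetNeZero _ h) • y

theorem unitExtend_matHom_singular {n : ℕ} {M : Type*} [AddCommGroup M]
    [Module (MonoidAlgebra K (Matrix.GeneralLinearGroup (Fin n) F)) M] (y : M)
    {A : Matrix (Fin n) (Fin n) F} (hA : A.det = 0) :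
    unitExtend (K := K) y (matHom A) = 0 := by
  have : LinearMap.toMatrix' (matHom A).hom.hom = A := LinearMap.toMatrix'_toLin' A
  rw [unitExtend, dif_pos (by rw [this, hA])]

theorem unitExtend_matHom_unit {n : ℕ} {M : Type*} [AddCommGroup M]
    [Module (MonoidAlgebra K (Matrix.GeneralLinearGroup (Fin n) F)) M] (y : M)
    (g : Matrix.GeneralLinearGroup (Fin n) F) :
    unitExtend (K := K) y (matHom g.1) = MonoidAlgebra.of K _ g • y := by
  have h1 : LinearMap.toMatrix' (matHom g.1).hom.hom = g.1 := LinearMap.toMatrix'_toLin' g.1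
  have h2 : g.1.det ≠ 0 := ((Matrix.isUnit_iff_isUnit_det g.1).1 g.isUnit).ne_zero
  rw [unitExtend, dif_neg (by rwa [h1])]
  congr 2
  exact Units.ext h1

end UnitExtend

/-! ### The counit and the equivalence -/

section Equivalence

variable {F : Type u} [Field F] [Finite F] {K : Type v} [CommRing K]

theorem isIso_toFamiliesHom (e : ∀ n, KovacsIdempotent F K n) (G : GenericRep.{u, v, w} F K) :
    IsIso (toFamiliesHom e G) := by
  have h : ∀ V, IsIso ((toFamiliesHom e G).app V) := by
    intro V
    set n := Module.finrank F V
    have i : V ≅ fnSpace F n :=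
      LinearEquiv.toFGModuleCatIso (Module.finBasis F V).equivFun
    have h1 : IsIso ((toFamiliesHom e G).app (fnSpace F n)) :=
      (ConcreteCategory.isIso_iff_bijective _).2
        ⟨toFamilies_injective e G n, toFamilies_surjective e G n⟩
    exact (NatTrans.isIso_app_iff_of_iso (toFamiliesHom e G) i).2 h1
  exact NatIso.isIso_of_isIso_app _

variable (F K) in
/-- The functor with components the functors `purePartFunctor F K n`. -/
def purePartsFunctor : GenericRep.{u, v, w} F K ⥤ ProdGLModules.{u, v, w} F K where
  obj G := pureParts G
  map f n := (purePartFunctor F K n).map f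
  map_id G := funext fun n => (purePartFunctor F K n).map_id G
  map_comp f g := funext fun n => (purePartFunctor F K n).map_comp f g

/-- A generic representation is naturally isomorphic to the families with values in its pure
parts. -/
def unitNatIso (e : ∀ n, KovacsIdempotent F K n) :
    𝟭 (GenericRep.{u, v, w} F K) ≅ purePartsFunctor F K ⋙ surjFamiliesFunctor F K :=
  NatIso.ofComponents (fun G => @asIso _ _ _ _ (toFamiliesHom e G) (isIso_toFamiliesHom e G))
    fun {G H} f => by
      refine NatTrans.ext (funext fun V => ModuleCat.hom_ext (LinearMap.ext fun (x : G.obj V) => ?_))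
      change toFamilies e H V ((f.app V).hom x) =
        surjFamilies.mapCoeff (M := pureParts G) (M' := pureParts H)
          (fun n => (purePartFunctor F K n).map f) (toFamilies e G V x)
      refine surjFamilies_ext_pureVal fun n s => ?_
      rw [pureVal_eval_toFamilies, surjFamilies.eval_mapCoeff]
      refine Eq.trans ?_ (pureVal_map f _).symm
      rw [pureVal_eval_toFamilies, ← KovacsIdempotent.proj_map]
      exact congrArg _ (NatTrans.naturality_apply f s x).symm

theorem surjFamilies.eval_id_map_unit {M : ProdGLModules.{u, v, w} F K} {n : ℕ}
    (h : surjFamilies M (fnSpace F n)) (g : Matrix.GeneralLinearGroup (Fin n) F) :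
    surjFamilies.eval n (𝟙 _) (surjFamilies.map (matHom g.1) h) =
      MonoidAlgebra.of K _ g • surjFamilies.eval n (𝟙 _) h := by
  rw [surjFamilies.eval_map, Category.comp_id, ← Category.id_comp (matHom g.1),
    surjFamilies.eval_comp_unit]

/-- Evaluation at the identity, on the pure part of the representation by families. -/
def evalId (M : ProdGLModules.{u, v, w} F K) (n : ℕ) :
    (purePartFunctor F K n).obj ((surjFamiliesFunctor F K).obj M) ⟶ M n :=
  ModuleCat.ofHom
    { toFun := fun y => surjFamilies.eval n (𝟙 _) (pureVal ((surjFamiliesFunctor F K).obj M) n y)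
      map_add' := fun _ _ => rfl
      map_smul' := map_smul_of_map_of_smul
        ((surjFamilies.eval n (𝟙 _)).toAddMonoidHom.comp
          (pureVal ((surjFamiliesFunctor F K).obj M) n).toAddMonoidHom)
        (fun c y => by
          have h := (pureVal ((surjFamiliesFunctor F K).obj M) n).map_smul c y
          exact (congrArg (surjFamilies.eval n (𝟙 _)) h).trans
            ((surjFamilies.eval n (𝟙 _)).map_smul c _))
        (fun g y => by
          have h := pureVal_of_smul g y
          exact (congrArg (surjFamilies.eval n (𝟙 _)) h).trans
            (surjFamilies.eval_id_map_unit _ g)) }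

theorem evalId_injective (M : ProdGLModules.{u, v, w} F K) (n : ℕ) :
    Function.Injective (evalId M n).hom := by
  rw [injective_iff_map_eq_zero]
  intro y hy
  refine pureVal_injective ?_
  rw [map_zero]
  have hmem := pureVal_mem y
  obtain ⟨h, hh⟩ : ∃ h : surjFamilies M (fnSpace F n),
    pureVal ((surjFamiliesFunctor F K).obj M) n y = h := ⟨_, rfl⟩
  rw [hh] at hmem ⊢
  have h0 : surjFamilies.eval n (𝟙 _) h = 0 := by rw [← hh]; exact hy
  refine surjFamilies.ext_eval (h' := 0) fun m s => ?_
  rw [map_zero]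
  by_cases hm : m = n
  · subst hm
    exact surjFamilies.eq_zero_of_eval_id h0 s
  · exact surjFamilies.eval_eq_zero_of_mem_purePart hmem hm s

theorem evalId_surjective (M : ProdGLModules.{u, v, w} F K) (n : ℕ) :
    Function.Surjective (evalId M n).hom := by
  intro y
  have hpos : ∀ s, Pi.single (M := fun m => (fnSpace F n ⟶ fnSpace F m) → M m) n
      (unitExtend (K := K) y) n s = unitExtend (K := K) y s := fun s => by rw [Pi.single_eq_same]
  have hneg : ∀ m, m ≠ n → ∀ s, Pi.single (M := fun m => (fnSpace F n ⟶ fnSpace F m) → M m) n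
      (unitExtend (K := K) y) m s = 0 := fun m hm s => by
    rw [Pi.single_eq_of_ne hm]
    rfl
  -- The preimage of y is concentrated in degree n and there on the invertible endomorphisms;
  -- composing with a singular matrix kills it, so it is pure.
  set h : surjFamilies M (fnSpace F n) := surjFamilies.mk
    (Pi.single (M := fun m => (fnSpace F n ⟶ fnSpace F m) → M m) n (unitExtend (K := K) y))
    (fun m s A hA => by
      by_cases hm : m = n
      · subst hm
        obtain ⟨B, rfl⟩ := exists_matHom_eq s
        rw [hpos, ← matHom_mul, unitExtend_matHom_singular]
        rw [Matrix.det_mul, hA, zero_mul]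
      · exact hneg m hm _)
    (fun m s g => by
      by_cases hm : m = n
      · subst hm
        obtain ⟨B, rfl⟩ := exists_matHom_eq s
        rw [hpos, hpos, ← matHom_mul]
        by_cases hB : B.det = 0
        · rw [unitExtend_matHom_singular _ hB, unitExtend_matHom_singular, smul_zero]
          rw [Matrix.det_mul, hB, mul_zero]
        · have h1 := unitExtend_matHom_unit (K := K) y
            (Matrix.GeneralLinearGroup.mkOfDetNeZero B hB)
          have h2 := unitExtend_matHom_unit (K := K) y
            (g * Matrix.GeneralLinearGroup.mkOfDetNeZero B hB)
          rw [map_mul, mul_smul, ← h1] at h2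
          exact h2
      · rw [hneg m hm, hneg m hm, smul_zero])
  have hev : ∀ m s, surjFamilies.eval m s h = Pi.single
      (M := fun m => (fnSpace F n ⟶ fnSpace F m) → M m) n (unitExtend (K := K) y) m s :=
    fun m s => surjFamilies.eval_mk _ _ _ m s
  have hmem : h ∈ GenericRep.purePart ((surjFamiliesFunctor F K).obj M) n := by
    refine GenericRep.mem_purePart.2 fun A hA => ?_
    refine surjFamilies.ext_eval (h := surjFamilies.map (matHom A) h) (h' := 0) fun m s => ?_
    rw [surjFamilies.eval_map, hev, map_zero]
    by_cases hm : m = n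
    · subst hm
      obtain ⟨B, rfl⟩ := exists_matHom_eq s
      rw [hpos, ← matHom_mul, unitExtend_matHom_singular]
      rw [Matrix.det_mul, hA, mul_zero]
    · exact hneg m hm _
  refine ⟨pureMk h hmem, ?_⟩
  change surjFamilies.eval n (𝟙 _) h = y
  rw [hev, hpos, ← matHom_one]
  refine (unitExtend_matHom_unit y 1).trans ?_
  rw [map_one, one_smul]

theorem isIso_evalId (M : ProdGLModules.{u, v, w} F K) (n : ℕ) : IsIso (evalId M n) :=
  (ConcreteCategory.isIso_iff_bijective _).2 ⟨evalId_injective M n, evalId_surjective M n⟩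

variable (F K) in
/-- The pure parts of the representation by families are the given modules. -/
def counitNatIso :
    surjFamiliesFunctor F K ⋙ purePartsFunctor F K ≅ 𝟭 (ProdGLModules.{u, v, w} F K) :=
  NatIso.ofComponents
    (fun M => Pi.isoMk fun n => @asIso _ _ _ _ (evalId M n) (isIso_evalId M n))
    fun {M _} φ => funext fun n => ModuleCat.hom_ext (LinearMap.ext fun y =>
      surjFamilies.eval_mapCoeff φ (pureVal ((surjFamiliesFunctor F K).obj M) n y) n (𝟙 _))

/-- The equivalence between generic representations and families of modules over the group
algebras of the general linear groups. -/
def genericRepEquivalence (e : ∀ n, KovacsIdempotent F K n) :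
    GenericRep.{u, v, w} F K ≌ ProdGLModules.{u, v, w} F K :=
  CategoryTheory.Equivalence.mk (purePartsFunctor F K) (surjFamiliesFunctor F K) (unitNatIso e)
    (counitNatIso F K)

theorem nonempty_kovacsIdempotent (hq : IsUnit (Nat.card F : K)) (n : ℕ) :
    Nonempty (KovacsIdempotent F K n) := by
  classical
  have := Fintype.ofFinite F
  rw [Nat.card_eq_fintype_card] at hq
  obtain ⟨x, h1, h2, h3⟩ := exists_singular_idempotent hq n
  exact ⟨⟨x, h1, h2, h3⟩⟩

theorem isUnit_natCast_card (F : Type*) [Field F] [Finite F] (p : ℕ) [CharP F p]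
    (K : Type*) [CommRing K] (hp : IsUnit (p : K)) : IsUnit (Nat.card F : K) := by
  have := Fintype.ofFinite F
  obtain ⟨n, -, hn⟩ := FiniteField.card F p
  rw [Nat.card_eq_fintype_card, hn, Nat.cast_pow]
  exact hp.pow _

end Equivalence

end

theorem theorem1p1 (F : Type u) [Field F] [Finite F] (p : ℕ) [CharP F p]
    (K : Type v) [CommRing K] (hp : IsUnit (p : K)) :
    ∃ e : GenericRep.{u, v, w} F K ≌ ProdGLModules.{u, v, w} F K,
      e.functor.Additive ∧ e.functor.Linear K ∧
        ∀ n : ℕ, Nonempty (e.functor ⋙ Pi.eval _ n ≅ purePartFunctor.{u, v, w} F K n) := by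
  have e : ∀ n, KovacsIdempotent F K n := fun n =>
    (nonempty_kovacsIdempotent (isUnit_natCast_card F p K hp) n).some
  refine ⟨genericRepEquivalence e, ⟨fun {G H f g} => ?_⟩, ⟨fun {G H} f c => ?_⟩, fun n => ⟨?_⟩⟩
  · exact funext fun n => ModuleCat.hom_ext (LinearMap.ext fun y => rfl)
  -- K acts on the target through the group algebra, so this is the K-linearity of `pureVal`.
  · refine funext fun n => ModuleCat.hom_ext (LinearMap.ext fun y => pureVal_injective ?_)
    exact ((pureVal H n).map_smul c (((purePartFunctor F K n).map f).hom y)).symm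
  · exact NatIso.ofComponents (fun G => Iso.refl _)
      fun f => (Category.comp_id _).trans (Category.id_comp _).symm
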